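/- Let $\mathbb{F}$ be a fixed finite field. A sequence $u=(u_n)_{n\in\mathbb{N}}$ over $\mathbb{F}$ is *polyrec of dimension $k\ge 1$* if there are sequences $u^{(1)}=u,u^{(2)},\dots,u^{(k)}$ over $\mathbb{F}$ and polynomials $P_1,\dots,P_k\in\mathbb{F}[x_1,\dots,x_k]$ with $u^{(i)}_{n+1}=P_i\big(u^{(1)}_n,\dots,u^{(k)}_n\big)$ for all $n\in\mathbb{N}$ and $1\le i\le k$. The *zeroness problem for polyrec sequences over $\mathbb{F}$* is: given a system $(P_1,\dots,P_k)$, encoded by an arithmetic circuit with $k$ output gates (input gates labelled with variables, constant gates labelled with elements of $\mathbb{F}$, binary addition and multiplication gates), and initial values $u^{(1)}_0,\dots,u^{(k)}_0\in\mathbb{F}$, decide whether $u^{(1)}_n=0$ for all $n\in\mathbb{N}$. Then the zeroness problem for polyrec sequences over $\mathbb{F}$ is in $\mathsf{PSPACE}$. Moreover, a polyrec sequence $u$ of dimension $k$ over $\mathbb{F}$ is zero if and only if $u_n=0$ for all $n<|\mathbb{F}|^k$. -/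

import Mathlib

/-! ### Polynomially recursive sequences -/

/-- `u : ℕ → F` is polynomially recursive of dimension `k` over `F`: it is the first of `k`
sequences `v · 0, …, v · (k - 1)` (so `k ≥ 1`) that satisfy a system of recurrences
`v (n + 1) i = P i (v n 0, …, v n (k - 1))` with polynomials `P i ∈ F[x₀, …, x_{k-1}]`. -/
def IsPolyrec {F : Type*} [Field F] (k : ℕ) (u : ℕ → F) : Prop :=
  ∃ (hk : 0 < k) (P : Fin k → MvPolynomial (Fin k) F) (v : ℕ → Fin k → F),
    (∀ n i, v (n + 1) i = MvPolynomial.eval (v n) (P i)) ∧ ∀ n, u n = v n ⟨0, hk⟩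

/-! ### Arithmetic circuits -/

/-- A gate of an arithmetic circuit over `F`: an input gate labelled with a variable, a constant
gate labelled with an element of `F`, or a binary addition or multiplication gate that refers to
two other gates of the circuit by their positions. -/
inductive Gate (F : Type) : Type
  | input (i : ℕ) : Gate F
  | const (a : F) : Gate F
  | add (i j : ℕ) : Gate F
  | mul (i j : ℕ) : Gate F

/-- The gate is admissible at position `n` of a circuit in `k` variables: the variable exists,
and the operands are earlier gates (the gates of a circuit are listed in topological order). -/
def Gate.WellFormed {F : Type} (k n : ℕ) : Gate F → Prop
  | .input i => i < k
  | .const _ => True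
  | .add i j => i < n ∧ j < n
  | .mul i j => i < n ∧ j < n

/-- The polynomial computed by a gate, given the polynomials `vs` computed by the earlier gates.
The default value `0` is never used for a well-formed gate. -/
noncomputable def Gate.poly {F : Type} [Field F] {k : ℕ} (vs : List (MvPolynomial (Fin k) F)) :
    Gate F → MvPolynomial (Fin k) F
  | .input i => if h : i < k then MvPolynomial.X ⟨i, h⟩ else 0
  | .const a => MvPolynomial.C a
  | .add i j => vs.getD i 0 + vs.getD j 0
  | .mul i j => vs.getD i 0 * vs.getD j 0

/-- The list of the polynomials computed by the gates of a circuit. -/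
noncomputable def circuitPolys {F : Type} [Field F] (k : ℕ) (gates : List (Gate F)) :
    List (MvPolynomial (Fin k) F) :=
  gates.foldl (fun vs g => vs ++ [g.poly vs]) []

/-! ### Instances of the zeroness problem -/

/-- A finite description of a polyrec sequence: a polyrec system whose polynomials are given by one
arithmetic circuit with one output gate for each polynomial, together with an initial condition.
The dimension is the number of initial values. -/
structure PolyrecSystem (F : Type) where
  /-- the initial condition -/
  initial : List F
  /-- the gates of the circuit, in topological order -/
  gates : List (Gate F)
  /-- the positions of the output gates -/
  outputs : List ℕ
  initial_pos : 0 < initial.length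
  gates_wellFormed : ∀ (n : ℕ) (h : n < gates.length), (gates[n]).WellFormed initial.length n
  outputs_length : outputs.length = initial.length
  outputs_lt : ∀ o ∈ outputs, o < gates.length

namespace PolyrecSystem

/-- The dimension of the system. -/
def dim {F : Type} (S : PolyrecSystem F) : ℕ := S.initial.length

/-- The polynomials on the right-hand sides of the system. -/
noncomputable def poly {F : Type} [Field F] (S : PolyrecSystem F) (i : Fin S.dim) :
    MvPolynomial (Fin S.dim) F :=
  (circuitPolys S.dim S.gates).getD (S.outputs.getD i 0) 0

/-- The tuple of all `S.dim` sequences that the system defines, at time `n`. -/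
noncomputable def state {F : Type} [Field F] (S : PolyrecSystem F) : ℕ → Fin S.dim → F
  | 0 => fun i => S.initial.get i
  | n + 1 => fun i => MvPolynomial.eval (S.state n) (S.poly i)

/-- The sequence defined by the system: the first one of the tuple. -/
noncomputable def seq {F : Type} [Field F] (S : PolyrecSystem F) (n : ℕ) : F :=
  S.state n ⟨0, S.initial_pos⟩

theorem isPolyrec_seq {F : Type} [Field F] (S : PolyrecSystem F) : IsPolyrec S.dim S.seq :=
  ⟨S.initial_pos, S.poly, S.state, fun _ _ => rfl, fun _ => rfl⟩

end PolyrecSystem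

/-! ### Instances as words over a finite alphabet -/

/-- The alphabet: one letter for each element of `F`, one for each kind of gate, a letter `tick` to
write numbers, an end mark for numbers, and a separator. -/
inductive Letter (F : Type) : Type
  | elem (a : F) : Letter F
  | input : Letter F
  | add : Letter F
  | mul : Letter F
  | tick : Letter F
  | endMark : Letter F
  | sep : Letter F

/-- The code of a number. -/
def natCode (F : Type) (n : ℕ) : List (Letter F) :=
  List.replicate n .tick ++ [.endMark]

/-- The code of a gate. -/
def Gate.code {F : Type} : Gate F → List (Letter F)
  | .input i => .input :: natCode F i
  | .const a => [.elem a]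
  | .add i j => .add :: (natCode F i ++ natCode F j)
  | .mul i j => .mul :: (natCode F i ++ natCode F j)

/-- The word that describes a system: initial values, gates, positions of the output gates.
All numbers that occur are smaller than the dimension or the number of gates, so that writing them
in unary keeps the length polynomial in the size of the circuit, see `length_encode_le`. -/
def PolyrecSystem.encode {F : Type} (S : PolyrecSystem F) : List (Letter F) :=
  S.initial.map .elem ++ .sep :: (S.gates.flatMap Gate.code ++ .sep ::
    S.outputs.flatMap (natCode F))

theorem natCode_append_inj {F : Type} {m n : ℕ} {r r' : List (Letter F)}
    (h : natCode F m ++ r = natCode F n ++ r') : m = n ∧ r = r' := by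
  induction m generalizing n with
  | zero =>
    cases n with
    | zero => simpa [natCode] using h
    | succ n => simp [natCode, List.replicate_succ] at h
  | succ m ih =>
    cases n with
    | zero => simp [natCode, List.replicate_succ] at h
    | succ n =>
      have h' : natCode F m ++ r = natCode F n ++ r' := by
        simpa [natCode, List.replicate_succ] using h
      simpa using ih h'

theorem Gate.code_append_inj {F : Type} {g g' : Gate F} {r r' : List (Letter F)}
    (h : g.code ++ r = g'.code ++ r') : g = g' ∧ r = r' := by
  cases g <;> cases g' <;>
    simp only [Gate.code, List.cons_append, List.append_assoc, List.nil_append, List.cons.injEq,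
      reduceCtorEq, false_and, true_and, Letter.elem.injEq] at h
  · obtain ⟨rfl, rfl⟩ := natCode_append_inj h
    simp
  · obtain ⟨rfl, rfl⟩ := h
    simp
  · obtain ⟨h1, h2⟩ := natCode_append_inj h
    obtain ⟨h3, h4⟩ := natCode_append_inj h2
    simp [h1, h3, h4]
  · obtain ⟨h1, h2⟩ := natCode_append_inj h
    obtain ⟨h3, h4⟩ := natCode_append_inj h2
    simp [h1, h3, h4]

/-- Different systems have different codes. -/
theorem PolyrecSystem.encode_injective {F : Type} :
    Function.Injective (PolyrecSystem.encode (F := F)) := by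
  have h1 : ∀ (l l' : List F) (r r' : List (Letter F)),
      l.map Letter.elem ++ .sep :: r = l'.map Letter.elem ++ .sep :: r' → l = l' ∧ r = r' := by
    intro l
    induction l with
    | nil => intro l' r r' h; cases l' <;> simp_all
    | cons a l ih =>
      intro l' r r' h
      cases l' with
      | nil => simp at h
      | cons b l' =>
        simp only [List.map_cons, List.cons_append, List.cons.injEq, Letter.elem.injEq] at h
        obtain ⟨rfl, rfl⟩ := ih l' r r' h.2
        simp [h.1]
  have h2 : ∀ (l l' : List (Gate F)) (r r' : List (Letter F)),
      l.flatMap Gate.code ++ .sep :: r = l'.flatMap Gate.code ++ .sep :: r' →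
        l = l' ∧ r = r' := by
    intro l
    induction l with
    | nil =>
      intro l' r r' h
      cases l' with
      | nil => simpa using h
      | cons b l' => cases b <;> simp [Gate.code] at h
    | cons a l ih =>
      intro l' r r' h
      cases l' with
      | nil => cases a <;> simp [Gate.code] at h
      | cons b l' =>
        simp only [List.flatMap_cons, List.append_assoc] at h
        obtain ⟨e1, e2⟩ := Gate.code_append_inj h
        obtain ⟨e3, e4⟩ := ih l' r r' e2
        simp [e1, e3, e4]
  have h3 : ∀ l l' : List ℕ, l.flatMap (natCode F) = l'.flatMap (natCode F) → l = l' := by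
    intro l
    induction l with
    | nil =>
      intro l' h
      cases l' with
      | nil => rfl
      | cons b l' => simp [natCode] at h
    | cons a l ih =>
      intro l' h
      cases l' with
      | nil => simp [natCode] at h
      | cons b l' =>
        simp only [List.flatMap_cons] at h
        obtain ⟨e1, e2⟩ := natCode_append_inj h
        rw [e1, ih l' e2]
  rintro ⟨i, g, o, _, _, _, _⟩ ⟨i', g', o', _, _, _, _⟩ h
  obtain ⟨e1, e2⟩ := h1 _ _ _ _ h
  obtain ⟨e3, e4⟩ := h2 _ _ _ _ e2
  have e5 := h3 _ _ e4
  simp only at e1 e3 e5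
  subst e1 e3 e5
  rfl

/-- The code has length quadratic in the dimension plus the number of gates. -/
theorem PolyrecSystem.length_encode_le {F : Type} (S : PolyrecSystem F) :
    S.encode.length ≤ 5 * (S.dim + S.gates.length + 1) ^ 2 := by
  have hg : ∀ g ∈ S.gates, g.code.length ≤ 2 * (S.dim + S.gates.length) + 3 := by
    intro g hg
    obtain ⟨n, hn, rfl⟩ := List.getElem_of_mem hg
    have h := S.gates_wellFormed n hn
    unfold PolyrecSystem.dim
    cases hx : S.gates[n] <;> simp [hx, Gate.WellFormed, Gate.code, natCode] at h ⊢ <;> omega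
  have ho : ∀ o ∈ S.outputs, (natCode F o).length ≤ S.dim + S.gates.length + 1 := by
    intro o ho
    have := S.outputs_lt o ho
    simp [natCode]
    omega
  have h1 : (S.gates.flatMap Gate.code).length ≤
      S.gates.length * (2 * (S.dim + S.gates.length) + 3) := by
    rw [List.length_flatMap]
    simpa using List.sum_le_card_nsmul (S.gates.map fun g => g.code.length)
      (2 * (S.dim + S.gates.length) + 3) (by simpa using hg)
  have h2 : (S.outputs.flatMap (natCode F)).length ≤
      S.dim * (S.dim + S.gates.length + 1) := by
    rw [List.length_flatMap]
    have := List.sum_le_card_nsmul (S.outputs.map fun o => (natCode F o).length)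
      (S.dim + S.gates.length + 1) (by simpa using ho)
    simpa [S.outputs_length, PolyrecSystem.dim] using this
  have h3 : S.encode.length = S.dim + ((S.gates.flatMap Gate.code).length + 1 +
      (S.outputs.flatMap (natCode F)).length) + 1 := by
    simp only [PolyrecSystem.encode, PolyrecSystem.dim, List.length_append, List.length_map,
      List.length_cons]
    omega
  nlinarith [Nat.zero_le (S.dim * S.gates.length), Nat.zero_le (S.dim ^ 2),
    Nat.zero_le (S.gates.length ^ 2)]

/-- The zeroness problem for polyrec sequences over `F`: the language of all codes of systems that
define the zero sequence. -/
def zeronessProblem (F : Type) [Field F] : Language (Letter F) :=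
  {w | ∃ S : PolyrecSystem F, S.encode = w ∧ ∀ n, S.seq n = 0}

/-! ### Polynomial space -/

/-- The space used by a configuration of a multi-stack Turing machine: the total number of symbols
on its stacks (including the stack that initially holds the input). -/
def configSpace (tm : Turing.FinTM2) (c : tm.Cfg) : ℕ :=
  letI := tm.kFin
  ∑ k : tm.K, (Turing.TM2.Cfg.stk c k).length

open Classical in
/-- The class `PSPACE` of languages over the alphabet `Γ`: some deterministic Turing machine with
finite stack alphabets decides membership of every word `w` (it halts and outputs a bit), and for
some polynomial `p` all configurations of its run on `w` use space at most `p |w|`.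
The finiteness of all stack alphabets is demanded here because `Turing.FinTM2` only demands it of
the input stack. -/
def PSPACE (Γ : Type) : Set (Language Γ) :=
  {L | ∃ M : Turing.TM2Computable (id : List Γ → List Γ) Computability.encodeBool
        (fun w => decide (w ∈ L)),
      (∀ k, Finite (M.tm.Γ k)) ∧
      ∃ p : Polynomial ℕ, ∀ (w : List Γ) (c : M.tm.Cfg),
        StateTransition.Reaches M.tm.step
          (Turing.initList M.tm (w.map M.inputAlphabet.invFun)) c →
        configSpace M.tm c ≤ p.eval w.length}

/-! ### Zeroness is determined by an initial segment -/

/-! Write `q` for the size of `F`. The tuple of all `k` sequences lives in the finite set of `q ^ k`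
points, and each tuple determines the next one. Among the first `q ^ k + 1` tuples two coincide, so
the orbit is eventually periodic and every tuple already occurs before time `q ^ k`
(`IsPolyrec.exists_lt_eq`). This gives the bound on the initial segment.

For the space bound it suffices to simulate `q ^ k` rounds of the recurrence. One round evaluates
the circuit gate by gate at the current tuple. It stores one field element per gate, where an
expanded polynomial could be exponentially large. The rounds are counted by `k` digits in base `q`.
All of this is linear in the length of the word.

The proof is split by an evaluator `evalCode` that works on the word itself and fails on ill-formed
words. It computes the recurrence on genuine codes (`evalCode_ofFn`), and its success certifies a
genuine code (`exists_of_evalCode_eq_some`). Membership in the language thereby becomes the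
statement `ZeroUpTo` about words (`mem_zeronessProblem_iff`). The stack machine then mirrors the
evaluator, failure corresponding to rejection (`outcome_check`), and its counter overflows after
exactly `q ^ k` rounds (`answers_check`). The space bound is independent of correctness: it is an
invariant of single steps (`cfgInv_stepAux`). -/

theorem IsPolyrec.exists_lt_eq {F : Type*} [Field F] [Finite F] {k : ℕ}
    {P : Fin k → MvPolynomial (Fin k) F} {v : ℕ → Fin k → F}
    (hv : ∀ n i, v (n + 1) i = MvPolynomial.eval (v n) (P i)) (n : ℕ) :
    ∃ m < Nat.card F ^ k, v n = v m := by
  classical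
  have := Fintype.ofFinite F
  have hcard : Fintype.card (Fin k → F) = Nat.card F ^ k := by simp
  obtain ⟨i, j, hij, hvij⟩ : ∃ i j : Fin (Nat.card F ^ k + 1), i ≠ j ∧ v i = v j :=
    Fintype.exists_ne_map_eq_of_card_lt (fun i : Fin (Nat.card F ^ k + 1) => v i)
      (by rw [hcard]; simp)
  wlog hlt : i < j generalizing i j
  · exact this j i hij.symm hvij.symm (lt_of_le_of_ne (not_lt.1 hlt) hij.symm)
  have hshift : ∀ d, v (i + d) = v (j + d) := by
    intro d
    induction d with
    | zero => exact hvij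
    | succ d ih =>
      funext a
      rw [← add_assoc, ← add_assoc, hv, hv, ih]
  have hlt' : (i : ℕ) < j := hlt
  induction n using Nat.strong_induction_on with
  | _ n ih =>
    by_cases hn : n < Nat.card F ^ k
    · exact ⟨n, hn, rfl⟩
    · have hj := j.is_lt
      -- One period `j - i` is removed from `n`; this is possible because `j ≤ q ^ k ≤ n`.
      obtain ⟨m, hm, h⟩ := ih (i + (n - j)) (by omega)
      refine ⟨m, hm, ?_⟩
      rw [← h, hshift]
      congr 1
      omega

theorem IsPolyrec.eq_zero_iff {F : Type*} [Field F] [Finite F] {k : ℕ} {u : ℕ → F}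
    (hu : IsPolyrec k u) : (∀ n, u n = 0) ↔ ∀ n < Nat.card F ^ k, u n = 0 := by
  obtain ⟨hk, P, v, hv, huv⟩ := hu
  refine ⟨fun h n _ => h n, fun h n => ?_⟩
  obtain ⟨m, hm, e⟩ := IsPolyrec.exists_lt_eq hv n
  rw [huv, e, ← huv]
  exact h m hm

namespace PolyrecSystem

variable {F : Type}

/-! ### Evaluation of a system directly on its code -/

/-- Reads a unary number from a word and returns the entry of `v` at that index together with the
rest of the word. -/
def look : List F → List (Letter F) → Option (F × List (Letter F))
  | b :: _, .endMark :: l => some (b, l)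
  | _ :: v, .tick :: l => look v l
  | _, _ => none

theorem look_natCode_append {v : List F} {j : ℕ} {b : F} (h : v[j]? = some b)
    (r : List (Letter F)) : look v (natCode F j ++ r) = some (b, r) := by
  induction v generalizing j with
  | nil => simp at h
  | cons a v ih =>
    cases j with
    | zero => simp_all [natCode, look]
    | succ j => exact ih (by simpa using h)

/-- Makes the evaluator double as a syntax check: reading succeeds only on a number that is a legal
index. -/
theorem exists_of_look_eq_some {v : List F} {l r : List (Letter F)} {b : F}
    (h : look v l = some (b, r)) : ∃ j < v.length, l = natCode F j ++ r := by
  induction v generalizing l with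
  | nil => simp [look] at h
  | cons a v ih =>
    match l, h with
    | .endMark :: l, h => exact ⟨0, by simp, by simp_all [look, natCode]⟩
    | .tick :: l, h =>
      obtain ⟨j, hj, rfl⟩ := ih (l := l) (by simpa [look] using h)
      exact ⟨j + 1, by simpa using hj, by simp [natCode, List.replicate_succ]⟩

theorem length_lt_of_look_eq_some {v : List F} {l r : List (Letter F)} {b : F}
    (h : look v l = some (b, r)) : r.length < l.length := by
  obtain ⟨j, -, rfl⟩ := exists_of_look_eq_some h
  simp [natCode]
  omega

/-- Splits a word into the initial values and the rest. -/
def splitInitial : List (Letter F) → Option (List F × List (Letter F))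
  | .elem a :: l => (splitInitial l).map fun p => (a :: p.1, p.2)
  | .sep :: l => some ([], l)
  | _ => none

theorem splitInitial_append (x : List F) (g : List (Letter F)) :
    splitInitial (x.map .elem ++ .sep :: g) = some (x, g) := by
  induction x with
  | nil => rfl
  | cons a x ih => simp [splitInitial, ih]

theorem eq_of_splitInitial_eq_some {w g : List (Letter F)} {x : List F}
    (h : splitInitial w = some (x, g)) : w = x.map .elem ++ .sep :: g := by
  induction w generalizing x with
  | nil => simp [splitInitial] at h
  | cons c w ih =>
    cases c <;> simp [splitInitial] at h
    · obtain ⟨x', h, rfl⟩ := h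
      simp [ih h]
    · simp [h]

/-- Reads a word that lists as many output gates as `x` has entries, and returns their values. -/
def evalOuts (v : List F) : List F → List (Letter F) → Option (List F)
  | [], [] => some []
  | [], _ :: _ => none
  | _ :: x, l => (look v l).bind fun p => (evalOuts v x p.2).map (p.1 :: ·)

theorem exists_of_evalOuts_eq_some {v x y : List F} {l : List (Letter F)}
    (h : evalOuts v x l = some y) : ∃ O : List ℕ, l = O.flatMap (natCode F) ∧
      O.length = x.length ∧ ∀ o ∈ O, o < v.length := by
  induction x generalizing l y with
  | nil =>
    cases l with
    | nil => exact ⟨[], by simp⟩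
    | cons c l => simp [evalOuts] at h
  | cons a x ih =>
    simp only [evalOuts, Option.bind_eq_some_iff, Option.map_eq_some_iff, Prod.exists] at h
    obtain ⟨b, r, h1, y', h2, -⟩ := h
    obtain ⟨j, hj, rfl⟩ := exists_of_look_eq_some h1
    obtain ⟨O, rfl, hlen, hO⟩ := ih h2
    exact ⟨j :: O, by simp, by simp [hlen], by simpa [hj] using hO⟩

/-- The code of a system without the initial values. -/
def tailCode (S : PolyrecSystem F) : List (Letter F) :=
  S.gates.flatMap Gate.code ++ .sep :: S.outputs.flatMap (natCode F)

theorem encode_eq (S : PolyrecSystem F) :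
    S.encode = S.initial.map .elem ++ .sep :: S.tailCode := rfl

variable [Field F]

/-- Evaluates, at the point `x`, the gates whose codes are at the beginning of a word. The values
are appended to the list `v` of the values of the earlier gates. The first argument bounds the
number of gates. -/
def evalGates (x : List F) : ℕ → List F → List (Letter F) → Option (List F × List (Letter F))
  | n + 1, v, .input :: l => (look x l).bind fun p => evalGates x n (v ++ [p.1]) p.2
  | n + 1, v, .elem a :: l => evalGates x n (v ++ [a]) l
  | n + 1, v, .add :: l => (look v l).bind fun p => (look v p.2).bind fun q =>
      evalGates x n (v ++ [p.1 + q.1]) q.2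
  | n + 1, v, .mul :: l => (look v l).bind fun p => (look v p.2).bind fun q =>
      evalGates x n (v ++ [p.1 * q.1]) q.2
  | _ + 1, v, .sep :: l => some (v, l)
  | _, _, _ => none

/-- Evaluates at `x` the system whose code without the initial values is `g`. -/
def evalCode (g : List (Letter F)) (x : List F) : Option (List F) :=
  (evalGates x (g.length + 1) [] g).bind fun p => evalOuts p.1 x p.2

/-- The first `n` tuples of the iteration of `evalCode g` from `x` begin with `0`, and each of them
has a successor. -/
def ZeroUpTo (g : List (Letter F)) : ℕ → List F → Prop
  | 0, _ => True
  | n + 1, x => x.head? = some 0 ∧ ∃ x', evalCode g x = some x' ∧ ZeroUpTo g n x'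

/-- Each successful round of the evaluator consumes exactly one gate code, and its lookups succeed
only for earlier positions. The gates parsed so far number `v.length`, hence the offset in the
positions. -/
theorem exists_of_evalGates_eq_some {x : List F} {n : ℕ} {v v' : List F} {l r : List (Letter F)}
    (h : evalGates x n v l = some (v', r)) : ∃ G : List (Gate F),
      l = G.flatMap Gate.code ++ .sep :: r ∧ v'.length = v.length + G.length ∧
      ∀ (n : ℕ) (h : n < G.length), (G[n]).WellFormed x.length (v.length + n) := by
  induction n generalizing v l with
  | zero => simp [evalGates] at h
  | succ n ih =>
    have key : ∀ (g : Gate F) (b : F) (l' : List (Letter F)),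
        g.WellFormed x.length v.length → l = g.code ++ l' →
        evalGates x n (v ++ [b]) l' = some (v', r) → ∃ G : List (Gate F),
          l = G.flatMap Gate.code ++ .sep :: r ∧ v'.length = v.length + G.length ∧
          ∀ (n : ℕ) (h : n < G.length), (G[n]).WellFormed x.length (v.length + n) := by
      intro g b l' hg hl h
      obtain ⟨G, e, hlen, hG⟩ := ih h
      refine ⟨g :: G, by simp [hl, e], by simp [hlen]; omega, fun m hm => ?_⟩
      cases m with
      | zero => exact hg
      | succ m => simpa [add_assoc, add_comm 1] using hG m (by simpa using hm)
    match l, h with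
    | .input :: l, h =>
      simp only [evalGates, Option.bind_eq_some_iff, Prod.exists] at h
      obtain ⟨b, l', h1, h⟩ := h
      obtain ⟨i, hi, rfl⟩ := exists_of_look_eq_some h1
      exact key (.input i) b l' hi rfl h
    | .elem a :: l, h => exact key (.const a) a l trivial rfl h
    | .add :: l, h =>
      simp only [evalGates, Option.bind_eq_some_iff, Prod.exists] at h
      obtain ⟨b, l', h1, c, l'', h2, h⟩ := h
      obtain ⟨i, hi, rfl⟩ := exists_of_look_eq_some h1
      obtain ⟨j, hj, rfl⟩ := exists_of_look_eq_some h2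
      exact key (.add i j) (b + c) l'' ⟨hi, hj⟩ (by simp [Gate.code]) h
    | .mul :: l, h =>
      simp only [evalGates, Option.bind_eq_some_iff, Prod.exists] at h
      obtain ⟨b, l', h1, c, l'', h2, h⟩ := h
      obtain ⟨i, hi, rfl⟩ := exists_of_look_eq_some h1
      obtain ⟨j, hj, rfl⟩ := exists_of_look_eq_some h2
      exact key (.mul i j) (b * c) l'' ⟨hi, hj⟩ (by simp [Gate.code]) h
    | .sep :: l, h =>
      simp only [evalGates, Option.some.injEq, Prod.mk.injEq] at h
      exact ⟨[], by simp [h.2], by simp [h.1], by simp⟩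

/-- Evaluation at a point is a ring homomorphism, so it commutes with every gate. The inequality
`hn` is strict because the separator also uses up one unit of the bound. -/
theorem evalGates_code {k : ℕ} (x : Fin k → F) (G : List (Gate F)) (r : List (Letter F)) {n : ℕ}
    (hn : G.length < n) (vs : List (MvPolynomial (Fin k) F))
    (hG : ∀ (n : ℕ) (h : n < G.length), (G[n]).WellFormed k (vs.length + n)) :
    evalGates (List.ofFn x) n (vs.map (MvPolynomial.eval x)) (G.flatMap Gate.code ++ .sep :: r) =
      some ((G.foldl (fun vs g => vs ++ [g.poly vs]) vs).map (MvPolynomial.eval x), r) := by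
  induction G generalizing n vs with
  | nil =>
    obtain ⟨n, rfl⟩ : ∃ m, n = m + 1 := ⟨n - 1, by simp at hn; omega⟩
    simp [evalGates]
  | cons g G ih =>
    obtain ⟨n, rfl⟩ : ∃ m, n = m + 1 := ⟨n - 1, by simp at hn; omega⟩
    have hg := hG 0 (by simp)
    have h := ih (n := n) (by simpa using hn) (vs ++ [g.poly vs]) (fun m hm => by
      have := hG (m + 1) (by simpa using hm)
      rw [List.length_append, List.length_singleton, add_assoc, add_comm 1]
      exact this)
    have hv : ∀ j (h : j < vs.length), (vs.map (MvPolynomial.eval x))[j]? =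
        some (MvPolynomial.eval x (vs.getD j 0)) := by
      intro j h
      simp [h]
    rw [List.foldl_cons, ← h]
    cases g with
    | input i =>
      have hi : i < k := hg
      have : (List.ofFn x)[i]? = some (x ⟨i, hi⟩) := by simp [hi]
      simp [Gate.code, evalGates, look_natCode_append this, Gate.poly, hi]
    | const a => simp [Gate.code, evalGates, Gate.poly]
    | add i j =>
      simp [Gate.code, evalGates, look_natCode_append (hv i hg.1),
        look_natCode_append (hv j hg.2), Gate.poly]
    | mul i j =>
      simp [Gate.code, evalGates, look_natCode_append (hv i hg.1),
        look_natCode_append (hv j hg.2), Gate.poly]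

theorem evalOuts_flatMap_natCode {v x : List F} {O : List ℕ} (hlen : O.length = x.length)
    (hO : ∀ o ∈ O, o < v.length) :
    evalOuts v x (O.flatMap (natCode F)) = some (O.map (v.getD · 0)) := by
  induction x generalizing O with
  | nil => simp_all [evalOuts]
  | cons a x ih =>
    cases O with
    | nil => simp at hlen
    | cons o O =>
      have ho : v[o]? = some (v.getD o 0) := by
        have := hO o (by simp)
        simp [this]
      simp only [List.flatMap_cons, evalOuts, look_natCode_append ho, Option.bind_some,
        ih (by simpa using hlen) (fun o h => hO o (by simp [h]))]
      simp

theorem length_circuitPolys (k : ℕ) (gates : List (Gate F)) :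
    (circuitPolys k gates).length = gates.length := by
  have : ∀ (G : List (Gate F)) (vs : List (MvPolynomial (Fin k) F)),
      (G.foldl (fun vs g => vs ++ [g.poly vs]) vs).length = vs.length + G.length := by
    intro G
    induction G with
    | nil => simp
    | cons g G ih => intro vs; simp [ih]; omega
  simpa [circuitPolys] using this gates []

theorem evalCode_ofFn (S : PolyrecSystem F) (x : Fin S.dim → F) :
    evalCode S.tailCode (List.ofFn x) =
      some (List.ofFn fun i => MvPolynomial.eval x (S.poly i)) := by
  -- Every gate code is nonempty, so the length of the word bounds the number of gates.
  have hlen : S.gates.length ≤ (S.gates.flatMap Gate.code).length := by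
    rw [List.length_flatMap]
    have := List.card_nsmul_le_sum (S.gates.map fun g => g.code.length) 1 (by
      simp only [List.mem_map, forall_exists_index, and_imp, forall_apply_eq_imp_iff₂]
      intro g _
      cases g <;> simp [Gate.code])
    simpa using this
  have h : evalGates (List.ofFn x) (S.tailCode.length + 1) [] S.tailCode =
      some ((circuitPolys S.dim S.gates).map (MvPolynomial.eval x),
        S.outputs.flatMap (natCode F)) :=
    evalGates_code x S.gates _ (by rw [tailCode, List.length_append]; omega) [] (by
      simpa [dim] using S.gates_wellFormed)
  rw [evalCode, h]
  rw [Option.bind_some, evalOuts_flatMap_natCode (by rw [List.length_ofFn, S.outputs_length, dim])]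
  · congr 1
    apply List.ext_getElem
    · simp [S.outputs_length, dim]
    · intro i h1 h2
      have h3 : i < S.outputs.length := by simpa using h1
      have h4 := S.outputs_lt _ (List.getElem_mem h3)
      have h5 := length_circuitPolys S.dim S.gates
      simp only [List.getElem_map, List.getElem_ofFn, poly]
      -- All positions are in range, so the default values on both sides never occur.
      rw [List.getD_eq_getElem _ _ h3, 
        List.getD_eq_getElem _ _ (by simpa [h5] using h4),
        List.getD_eq_getElem _ _ (by simpa [h5] using h4), List.getElem_map]
  · intro o ho
    rw [List.length_map, length_circuitPolys]
    exact S.outputs_lt o ho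

theorem exists_of_evalCode_eq_some {g : List (Letter F)} {x x' : List F} (hx : 0 < x.length)
    (h : evalCode g x = some x') :
    ∃ S : PolyrecSystem F, S.initial = x ∧ S.tailCode = g := by
  simp only [evalCode, Option.bind_eq_some_iff, Prod.exists] at h
  obtain ⟨v, r, h1, h2⟩ := h
  obtain ⟨G, rfl, hlen, hG⟩ := exists_of_evalGates_eq_some h1
  obtain ⟨O, rfl, hOl, hO⟩ := exists_of_evalOuts_eq_some h2
  exact ⟨⟨x, G, O, hx, by simpa using hG, hOl, by simpa [hlen] using hO⟩, rfl, rfl⟩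

theorem zeroUpTo_ofFn_state (S : PolyrecSystem F) (n m : ℕ) :
    ZeroUpTo S.tailCode n (List.ofFn (S.state m)) ↔ ∀ i < n, S.seq (m + i) = 0 := by
  induction n generalizing m with
  | zero => simp [ZeroUpTo]
  | succ n ih =>
    have h0 : (List.ofFn (S.state m)).head? = some (S.seq m) := by
      rw [List.head?_eq_getElem?]
      have : 0 < S.dim := S.initial_pos
      simp [this, seq]
    have h1 : (fun i => MvPolynomial.eval (S.state m) (S.poly i)) = S.state (m + 1) := rfl
    simp only [ZeroUpTo, h0, evalCode_ofFn, h1, Option.some.injEq, exists_eq_left', ih]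
    rw [Nat.forall_lt_succ_left]
    simp [add_assoc, add_comm 1]

theorem ofFn_state_zero (S : PolyrecSystem F) : List.ofFn (S.state 0) = S.initial := by
  apply List.ext_getElem <;> simp [dim, state]

variable [Finite F]

/-- No separate test for well-formedness is needed: `q ^ x.length` is positive, so `ZeroUpTo`
includes at least one round. That round forces `x` to be nonempty and the evaluation of `g` to
succeed, whence the word is the code of a system. -/
theorem mem_zeronessProblem_iff (w : List (Letter F)) :
    w ∈ zeronessProblem F ↔ ∃ x g, splitInitial w = some (x, g) ∧
      ZeroUpTo g (Nat.card F ^ x.length) x := by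
  have key : ∀ S : PolyrecSystem F, (∀ n, S.seq n = 0) ↔
      ZeroUpTo S.tailCode (Nat.card F ^ S.initial.length) S.initial := by
    intro S
    have h := zeroUpTo_ofFn_state S (Nat.card F ^ S.dim) 0
    simp only [zero_add, ofFn_state_zero] at h
    rw [S.isPolyrec_seq.eq_zero_iff, ← h, dim]
  constructor
  · rintro ⟨S, rfl, h⟩
    exact ⟨S.initial, S.tailCode, by rw [encode_eq, splitInitial_append], (key S).1 h⟩
  · rintro ⟨x, g, hw, h⟩
    have hpos : 0 < Nat.card F ^ x.length := pow_pos Nat.card_pos _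
    obtain ⟨N, hN⟩ : ∃ N, Nat.card F ^ x.length = N + 1 := ⟨_, (Nat.succ_pred hpos.ne').symm⟩
    have h' := h
    rw [hN] at h'
    obtain ⟨hx, x', hx', -⟩ := h'
    have hx0 : 0 < x.length := by
      cases x <;> simp_all
    obtain ⟨S, rfl, rfl⟩ := exists_of_evalCode_eq_some hx0 hx'
    exact ⟨S, (eq_of_splitInitial_eq_some hw).symm, (key S).2 h⟩

end PolyrecSystem

namespace ZeronessMachine

open Turing StateTransition PolyrecSystem

/-! ### The machine -/

/-- The working stacks: the unread and the read part of the input, the current and the next tuple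
of values, the values of the gates, an auxiliary stack and a counter. -/
inductive Work : Type
  | inp | done | cur | nxt | vals | aux | cnt
  deriving DecidableEq

/-- The stacks of the machine: the working stacks and the output stack. -/
inductive Stack : Type
  | work (k : Work)
  | out
  deriving DecidableEq

instance : Fintype Stack where
  elems := {.work .inp, .work .done, .work .cur, .work .nxt, .work .vals, .work .aux,
    .work .cnt, .out}
  complete k := by rcases k with (_ | _) | _ <;> simp

/-- The stack alphabets. -/
abbrev Sym (F : Type) : Stack → Type
  | .work _ => Letter F
  | .out => Bool

/-- What is done with a value that has been read from the stack of gate values: it is the first or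
the second operand of a multiplication (`true`) or an addition (`false`), or an output value. -/
inductive Use (F : Type) : Type
  | fst (m : Bool)
  | snd (m : Bool) (a : F)
  | out
  deriving Fintype

/-- The labels of the machine. -/
inductive Lbl (F : Type) : Type
  | init | load | check | gates | lookCur
  | restCur (b : F) | append (b : F) | restGates
  | lookVal (u : Use F) | restVal (u : Use F) (b : F)
  | outs | emit (b : F) | fin | clearVals | rewind | inc | restCnt
  | clear (b : Bool)
  deriving Fintype

/-- The register holds the letter that has been read last. -/
abbrev Reg (F : Type) := Option (Letter F)

/-- Statements of the machine. -/
abbrev Stm (F : Type) := TM2.Stmt (Sym F) (Lbl F) (Reg F)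

/-- The letter in the register. The default value is never used. -/
def letter {F : Type} (c : Reg F) : Letter F := c.getD .sep

def isElem {F : Type} : Reg F → Bool
  | some (.elem _) => true
  | _ => false

def isTick {F : Type} : Reg F → Bool
  | some .tick => true
  | _ => false

def isEndMark {F : Type} : Reg F → Bool
  | some .endMark => true
  | _ => false

/-- Remember the letter that has been read. -/
def read {F : Type} (_ c : Reg F) : Reg F := c

section Programs

open TM2.Stmt

variable {F : Type}

/-- Reject. -/
def reject : Stm F := goto fun _ => .clear false

/-- Move all of `src` to `dst`, then go to `exit`. -/
def move (src dst : Work) (self exit : Lbl F) : Stm F :=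
  pop (.work src) read <| branch Option.isSome
    (push (.work dst) letter <| goto fun _ => self)
    (goto fun _ => exit)

/-- Read a unary number from the input while moving that many entries from `src` to the auxiliary
stack. Then go to `exit b` where `b` is the next entry. -/
def lookup (src : Work) (self : Lbl F) (exit : F → Lbl F) : Stm F :=
  pop (.work .inp) read <| push (.work .done) letter <| branch isTick
    (pop (.work src) read <| branch Option.isSome
      (push (.work .aux) letter <| goto fun _ => self)
      reject)
    (branch isEndMark
      (peek (.work src) read <| goto fun c =>
        match c with
        | some (.elem b) => exit b
        | _ => .clear false)
      reject)

variable [Field F]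

/-- Where to go with a value that has been read from the stack of gate values. -/
def Use.next (b : F) : Use F → Lbl F
  | .fst m => .lookVal (.snd m b)
  | .snd m a => .append (if m then a * b else a + b)
  | .out => .emit b

variable [Finite F]

/-- The smallest digit of the counter. -/
noncomputable def digitZero : F := (Finite.equivFin F).symm ⟨0, Nat.card_pos⟩

/-- The next digit. -/
noncomputable def digitSucc (a : F) : Option F :=
  if h : (Finite.equivFin F a : ℕ) + 1 < Nat.card F then some ((Finite.equivFin F).symm ⟨_, h⟩)
  else none

/-- The successor of the digit in the register. -/
noncomputable def regSucc : Reg F → Option F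
  | some (.elem a) => digitSucc a
  | _ => none

open Classical in
/-- The program of the machine. -/
noncomputable def prog : Lbl F → Stm F
  | .init => pop (.work .inp) read <| branch isElem
      (push (.work .nxt) letter <| push (.work .cnt) (fun _ => .elem digitZero) <|
        goto fun _ => .init)
      (goto fun c =>
        match c with
        | some .sep => .load
        | _ => .clear false)
  | .load => move .nxt .cur .load .check
  | .check => peek (.work .cur) read <| goto fun c =>
      match c with
      | some (.elem a) => if a = 0 then .gates else .clear false
      | _ => .clear false
  | .gates => pop (.work .inp) read <| push (.work .done) letter <| goto fun c =>
      match c with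
      | some .input => .lookCur
      | some (.elem a) => .append a
      | some .add => .lookVal (.fst false)
      | some .mul => .lookVal (.fst true)
      | some .sep => .outs
      | _ => .clear false
  | .lookCur => lookup .cur .lookCur .restCur
  | .restCur b => move .aux .cur (.restCur b) (.append b)
  | .append b => pop (.work .vals) read <| branch Option.isSome
      (push (.work .aux) letter <| goto fun _ => .append b)
      (push (.work .aux) (fun _ => .elem b) <| goto fun _ => .restGates)
  | .restGates => move .aux .vals .restGates .gates
  | .lookVal u => lookup .vals (.lookVal u) (.restVal u)
  | .restVal u b => move .aux .vals (.restVal u b) (u.next b)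
  | .emit b => pop (.work .cur) read <| branch Option.isSome
      (push (.work .nxt) (fun _ => .elem b) <| goto fun _ => .outs)
      reject
  | .outs => peek (.work .inp) read <| goto fun c =>
      match c with
      | none => .fin
      | _ => .lookVal .out
  | .fin => peek (.work .cur) read <| goto fun c =>
      match c with
      | none => .clearVals
      | _ => .clear false
  | .clearVals => pop (.work .vals) read <| goto fun c =>
      match c with
      | none => .rewind
      | _ => .clearVals
  | .rewind => move .done .inp .rewind .inc
  | .inc => pop (.work .cnt) read <| branch Option.isSome
      (branch (fun c => (regSucc c).isSome)
        (push (.work .cnt) (fun c => .elem ((regSucc c).getD 0)) <| goto fun _ => .restCnt)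
        (push (.work .aux) (fun _ => .elem digitZero) <| goto fun _ => .inc))
      (goto fun _ => .clear true)
  | .restCnt => move .aux .cnt .restCnt .load
  | .clear b =>
      pop (.work .inp) read <| pop (.work .done) Option.or <| pop (.work .cur) Option.or <|
      pop (.work .nxt) Option.or <| pop (.work .vals) Option.or <| pop (.work .aux) Option.or <|
      pop (.work .cnt) Option.or <| branch Option.isSome
        (goto fun _ => .clear b)
        (push .out (fun _ => b) halt)

end Programs

/-! ### Memory contents and runs -/

/-- The contents of the working stacks. -/
structure Mem (F : Type) : Type where
  inp : List (Letter F)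
  done : List (Letter F)
  cur : List (Letter F)
  nxt : List (Letter F)
  vals : List (Letter F)
  aux : List (Letter F)
  cnt : List (Letter F)

/-- The contents of all stacks before the output is written. -/
def Mem.stk {F : Type} (t : Mem F) : ∀ k, List (Sym F k)
  | .work .inp => t.inp
  | .work .done => t.done
  | .work .cur => t.cur
  | .work .nxt => t.nxt
  | .work .vals => t.vals
  | .work .aux => t.aux
  | .work .cnt => t.cnt
  | .out => []

section Update

variable {F : Type} {i d x y v a c : List (Letter F)}

@[simp] theorem stk_inp : Mem.stk ⟨i, d, x, y, v, a, c⟩ (.work .inp) = i := rfl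
@[simp] theorem stk_done : Mem.stk ⟨i, d, x, y, v, a, c⟩ (.work .done) = d := rfl
@[simp] theorem stk_cur : Mem.stk ⟨i, d, x, y, v, a, c⟩ (.work .cur) = x := rfl
@[simp] theorem stk_nxt : Mem.stk ⟨i, d, x, y, v, a, c⟩ (.work .nxt) = y := rfl
@[simp] theorem stk_vals : Mem.stk ⟨i, d, x, y, v, a, c⟩ (.work .vals) = v := rfl
@[simp] theorem stk_aux : Mem.stk ⟨i, d, x, y, v, a, c⟩ (.work .aux) = a := rfl
@[simp] theorem stk_cnt : Mem.stk ⟨i, d, x, y, v, a, c⟩ (.work .cnt) = c := rfl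
@[simp] theorem stk_out : Mem.stk ⟨i, d, x, y, v, a, c⟩ .out = [] := rfl

variable (l : List (Letter F))

-- These lemmas bring the stacks back to the form `Mem.stk ⟨…⟩` after every push and pop, so that
-- `simp` can execute a statement symbolically.
@[simp] theorem update_inp : Function.update (Mem.stk ⟨i, d, x, y, v, a, c⟩) (.work .inp) l =
    Mem.stk ⟨l, d, x, y, v, a, c⟩ := by
  funext k; rcases k with (_ | _) | _ <;> rfl

@[simp] theorem update_done : Function.update (Mem.stk ⟨i, d, x, y, v, a, c⟩) (.work .done) l =
    Mem.stk ⟨i, l, x, y, v, a, c⟩ := by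
  funext k; rcases k with (_ | _) | _ <;> rfl

@[simp] theorem update_cur : Function.update (Mem.stk ⟨i, d, x, y, v, a, c⟩) (.work .cur) l =
    Mem.stk ⟨i, d, l, y, v, a, c⟩ := by
  funext k; rcases k with (_ | _) | _ <;> rfl

@[simp] theorem update_nxt : Function.update (Mem.stk ⟨i, d, x, y, v, a, c⟩) (.work .nxt) l =
    Mem.stk ⟨i, d, x, l, v, a, c⟩ := by
  funext k; rcases k with (_ | _) | _ <;> rfl

@[simp] theorem update_vals : Function.update (Mem.stk ⟨i, d, x, y, v, a, c⟩) (.work .vals) l =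
    Mem.stk ⟨i, d, x, y, l, a, c⟩ := by
  funext k; rcases k with (_ | _) | _ <;> rfl

@[simp] theorem update_aux : Function.update (Mem.stk ⟨i, d, x, y, v, a, c⟩) (.work .aux) l =
    Mem.stk ⟨i, d, x, y, v, l, c⟩ := by
  funext k; rcases k with (_ | _) | _ <;> rfl

@[simp] theorem update_cnt : Function.update (Mem.stk ⟨i, d, x, y, v, a, c⟩) (.work .cnt) l =
    Mem.stk ⟨i, d, x, y, v, a, l⟩ := by
  funext k; rcases k with (_ | _) | _ <;> rfl

end Update

variable {F : Type} [Field F] [Finite F]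

/-- From the label `l` and the memory contents `t`, with any letter in the register, the machine
gets to the label `l'` and the memory contents `t'`. -/
structure Leads (l : Lbl F) (t : Mem F) (l' : Lbl F) (t' : Mem F) : Prop where
  reaches : ∀ s, ∃ s', Reaches (TM2.step prog) ⟨some l, s, t.stk⟩ ⟨some l', s', t'.stk⟩

/-- The machine gets to the label for rejection. -/
def Rejects (l : Lbl F) (t : Mem F) : Prop := ∃ t', Leads l t (.clear false) t'

theorem Leads.refl (l : Lbl F) (t : Mem F) : Leads l t l t :=
  ⟨fun s => ⟨s, Relation.ReflTransGen.refl⟩⟩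

theorem Leads.trans {l l' l'' : Lbl F} {t t' t'' : Mem F} (h : Leads l t l' t')
    (h' : Leads l' t' l'' t'') : Leads l t l'' t'' := by
  refine ⟨fun s => ?_⟩
  obtain ⟨s', h1⟩ := h.reaches s
  obtain ⟨s'', h2⟩ := h'.reaches s'
  exact ⟨s'', h1.trans h2⟩

theorem Leads.rejects {l l' : Lbl F} {t t' : Mem F} (h : Leads l t l' t') (h' : Rejects l' t') :
    Rejects l t := by
  obtain ⟨t'', h'⟩ := h'
  exact ⟨t'', h.trans h'⟩

/-- The register after the step stays existential, so only label and stacks have to be computed. -/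
theorem Leads.of_step {l l' : Lbl F} {t t' : Mem F}
    (h : ∀ s, (TM2.stepAux (prog l) s t.stk).l = some l' ∧
      (TM2.stepAux (prog l) s t.stk).stk = t'.stk) : Leads l t l' t' := by
  refine ⟨fun s => ⟨(TM2.stepAux (prog l) s t.stk).var, Relation.ReflTransGen.single ?_⟩⟩
  obtain ⟨h1, h2⟩ := h s
  simp only [TM2.step, Option.mem_def, ← h1, ← h2]

/-- The machine gets to the label `L p` with memory contents described by `Q p` if `o = some p`,
and it rejects if `o = none`. -/
def Outcome {α : Type} (l : Lbl F) (t : Mem F) (o : Option α) (L : α → Lbl F)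
    (Q : α → Mem F → Prop) : Prop :=
  match o with
  | none => Rejects l t
  | some p => ∃ t', Q p t' ∧ Leads l t (L p) t'

theorem Leads.outcome {α : Type} {l l' : Lbl F} {t t' : Mem F} (h : Leads l t l' t')
    {o : Option α} {L : α → Lbl F} {Q : α → Mem F → Prop} (h' : Outcome l' t' o L Q) :
    Outcome l t o L Q := by
  cases o with
  | none => exact h.rejects h'
  | some p =>
    obtain ⟨t'', hQ, h'⟩ := h'
    exact ⟨t'', hQ, h.trans h'⟩

/-- Sequential composition of programs matches composition of partial functions; this lets the
machine be verified along the recursion of the evaluator. -/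
theorem Outcome.bind {α β : Type} {l : Lbl F} {t : Mem F} {o : Option α} {f : α → Option β}
    {L : α → Lbl F} {L' : β → Lbl F} {Q : α → Mem F → Prop} {Q' : β → Mem F → Prop}
    (h : Outcome l t o L Q) (h' : ∀ p t', o = some p → Q p t' → Outcome (L p) t' (f p) L' Q') :
    Outcome l t (o.bind f) L' Q' := by
  cases o with
  | none => exact h
  | some p =>
    obtain ⟨t', hQ, h⟩ := h
    exact h.outcome (h' p t' rfl hQ)

theorem Outcome.map {α β : Type} {l : Lbl F} {t : Mem F} {o : Option α} {f : α → β}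
    {L : α → Lbl F} {L' : β → Lbl F} {Q : α → Mem F → Prop} {Q' : β → Mem F → Prop}
    (h : Outcome l t o L Q) (h' : ∀ p t', Q p t' → Leads (L p) t' (L' (f p)) t' ∧ Q' (f p) t') :
    Outcome l t (o.map f) L' Q' := by
  cases o with
  | none => exact h
  | some p =>
    obtain ⟨t', hQ, h⟩ := h
    exact ⟨t', (h' p t' hQ).2, h.trans (h' p t' hQ).1⟩

attribute [local simp] prog lookup move reject read letter isTick isEndMark isElem regSucc

theorem rejects_of_step {l : Lbl F} {t : Mem F} (t' : Mem F)
    (h : ∀ s, (TM2.stepAux (prog l) s t.stk).l = some (.clear false) ∧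
      (TM2.stepAux (prog l) s t.stk).stk = t'.stk) : Rejects l t :=
  ⟨t', .of_step h⟩

/-! ### Loops that move the contents of a stack -/

section Moves

variable (i d x y v a c : List (Letter F))

/-- Moving a stack reverses it. In this and the following loops the source was itself filled in
reverse, so the original order is restored. -/
theorem leads_load : Leads .load ⟨i, d, x, y, v, a, c⟩ .check
    ⟨i, d, y.reverse ++ x, [], v, a, c⟩ := by
  induction y generalizing x with
  | nil => exact .of_step fun s => by simp
  | cons b y ih =>
    refine .trans (l' := .load) (t' := ⟨i, d, b :: x, y, v, a, c⟩) (.of_step fun s => by simp) ?_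
    simpa using ih (b :: x)

theorem leads_restCur (b : F) : Leads (.restCur b) ⟨i, d, x, y, v, a, c⟩ (.append b)
    ⟨i, d, a.reverse ++ x, y, v, [], c⟩ := by
  induction a generalizing x with
  | nil => exact .of_step fun s => by simp
  | cons b' a ih =>
    refine .trans (l' := .restCur b) (t' := ⟨i, d, b' :: x, y, v, a, c⟩) (.of_step fun s => by simp) ?_
    simpa using ih (b' :: x)

theorem leads_restVal (u : Use F) (b : F) : Leads (.restVal u b) ⟨i, d, x, y, v, a, c⟩ (u.next b)
    ⟨i, d, x, y, a.reverse ++ v, [], c⟩ := by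
  induction a generalizing v with
  | nil => exact .of_step fun s => by simp
  | cons b' a ih =>
    refine .trans (l' := .restVal u b) (t' := ⟨i, d, x, y, b' :: v, a, c⟩) (.of_step fun s => by simp) ?_
    simpa using ih (b' :: v)

theorem leads_restGates : Leads .restGates ⟨i, d, x, y, v, a, c⟩ .gates
    ⟨i, d, x, y, a.reverse ++ v, [], c⟩ := by
  induction a generalizing v with
  | nil => exact .of_step fun s => by simp
  | cons b a ih =>
    refine .trans (l' := .restGates) (t' := ⟨i, d, x, y, b :: v, a, c⟩) (.of_step fun s => by simp) ?_
    simpa using ih (b :: v)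

theorem leads_restCnt : Leads .restCnt ⟨i, d, x, y, v, a, c⟩ .load
    ⟨i, d, x, y, v, [], a.reverse ++ c⟩ := by
  induction a generalizing c with
  | nil => exact .of_step fun s => by simp
  | cons b a ih =>
    refine .trans (l' := .restCnt) (t' := ⟨i, d, x, y, v, a, b :: c⟩) (.of_step fun s => by simp) ?_
    simpa using ih (b :: c)

theorem leads_rewind : Leads .rewind ⟨i, d, x, y, v, a, c⟩ .inc
    ⟨d.reverse ++ i, [], x, y, v, a, c⟩ := by
  induction d generalizing i with
  | nil => exact .of_step fun s => by simp
  | cons b d ih =>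
    refine .trans (l' := .rewind) (t' := ⟨b :: i, d, x, y, v, a, c⟩) (.of_step fun s => by simp) ?_
    simpa using ih (b :: i)

theorem leads_clearVals : Leads .clearVals ⟨i, d, x, y, v, a, c⟩ .rewind
    ⟨i, d, x, y, [], a, c⟩ := by
  induction v with
  | nil => exact .of_step fun s => by simp
  | cons b v ih =>
    exact .trans (l' := .clearVals) (t' := ⟨i, d, x, y, v, a, c⟩) (.of_step fun s => by simp) ih

/-- A new value has to go to the bottom, since gate `j` is looked up `j` entries below the top. The
values are poured onto the auxiliary stack, the new one is put on top, and all are poured back. -/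
theorem leads_append (b : F) : Leads (.append b) ⟨i, d, x, y, v, [], c⟩ .gates
    ⟨i, d, x, y, v ++ [.elem b], [], c⟩ := by
  have h : ∀ v a, Leads (.append b) ⟨i, d, x, y, v, a, c⟩ .restGates
      ⟨i, d, x, y, [], .elem b :: (v.reverse ++ a), c⟩ := by
    intro v
    induction v with
    | nil => exact fun a => .of_step fun s => by simp
    | cons b' v ih =>
      intro a
      refine .trans (l' := .append b) (t' := ⟨i, d, x, y, v, b' :: a, c⟩) (.of_step fun s => by simp) ?_
      simpa using ih (b' :: a)
  simpa using (h v []).trans (leads_restGates ..)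

end Moves

/-! ### Reading operands and simulating one round of evaluation -/

section Lookup

variable (l d y c : List (Letter F))

/-- The stack `a` collects the entries already passed. The equation for `d'` records that no letter
of the input is lost, as the later rewinding requires. -/
theorem outcome_lookCur_aux (x : List F) (a v : List (Letter F)) :
    Outcome .lookCur ⟨l, d, x.map .elem, y, v, a, c⟩ (look x l) (fun p => .append p.1)
      (fun p t => ∃ d', t = ⟨p.2, d', a.reverse ++ x.map .elem, y, v, [], c⟩ ∧
        d'.reverse ++ p.2 = d.reverse ++ l) := by
  induction l generalizing x d a with
  | nil =>
    rw [show look x [] = none by cases x <;> rfl]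
    -- Popping the empty input yields no letter, so the default `.sep` is pushed.
    exact rejects_of_step ⟨[], .sep :: d, x.map .elem, y, v, a, c⟩ fun s => by simp
  | cons b l ih =>
    rcases b with b | _ | _ | _ | _ | _ | _
    case tick =>
      cases x with
      | nil => exact rejects_of_step ⟨l, .tick :: d, [], y, v, a, c⟩ fun s => by simp
      | cons b x =>
        refine Leads.outcome (l' := .lookCur) (t' := ⟨l, .tick :: d, x.map .elem, y, v, .elem b :: a, c⟩)
          (.of_step fun s => by simp) ?_
        simpa [look] using ih (.tick :: d) x (.elem b :: a)
    case endMark =>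
      cases x with
      | nil => exact rejects_of_step ⟨l, .endMark :: d, [], y, v, a, c⟩ fun s => by simp
      | cons b x =>
        refine ⟨_, ⟨.endMark :: d, rfl, by simp⟩, (Leads.of_step (t' := ⟨l, .endMark :: d, _, y, v, a, c⟩) (fun s => ?_)).trans
          (leads_restCur ..)⟩
        simp
    all_goals
      rw [look.eq_3 _ _ (by simp) (by simp)]
      exact rejects_of_step ⟨l, _ :: d, x.map .elem, y, v, a, c⟩ fun s => by simp; rfl

theorem outcome_lookVal_aux (u : Use F) (v : List F) (a x : List (Letter F)) :
    Outcome (.lookVal u) ⟨l, d, x, y, v.map .elem, a, c⟩ (look v l) (fun p => u.next p.1)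
      (fun p t => ∃ d', t = ⟨p.2, d', x, y, a.reverse ++ v.map .elem, [], c⟩ ∧
        d'.reverse ++ p.2 = d.reverse ++ l) := by
  induction l generalizing v d a with
  | nil =>
    rw [show look v [] = none by cases v <;> rfl]
    exact rejects_of_step ⟨[], .sep :: d, x, y, v.map .elem, a, c⟩ fun s => by simp
  | cons b l ih =>
    rcases b with b | _ | _ | _ | _ | _ | _
    case tick =>
      cases v with
      | nil => exact rejects_of_step ⟨l, .tick :: d, x, y, [], a, c⟩ fun s => by simp
      | cons b v =>
        refine Leads.outcome (l' := .lookVal u) (t' := ⟨l, .tick :: d, x, y, v.map .elem, .elem b :: a, c⟩)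
          (.of_step fun s => by simp) ?_
        simpa [look] using ih (.tick :: d) v (.elem b :: a)
    case endMark =>
      cases v with
      | nil => exact rejects_of_step ⟨l, .endMark :: d, x, y, [], a, c⟩ fun s => by simp
      | cons b v =>
        refine ⟨_, ⟨.endMark :: d, rfl, by simp⟩, (Leads.of_step (t' := ⟨l, .endMark :: d, x, y, _, a, c⟩) (fun s => ?_)).trans
          (leads_restVal ..)⟩
        simp
    all_goals
      rw [look.eq_3 _ _ (by simp) (by simp)]
      exact rejects_of_step ⟨l, _ :: d, x, y, v.map .elem, a, c⟩ fun s => by simp; rfl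

end Lookup

theorem outcome_lookCur (l d y c v : List (Letter F)) (x : List F) :
    Outcome .lookCur ⟨l, d, x.map .elem, y, v, [], c⟩ (look x l) (fun p => .append p.1)
      (fun p t => ∃ d', t = ⟨p.2, d', x.map .elem, y, v, [], c⟩ ∧
        d'.reverse ++ p.2 = d.reverse ++ l) :=
  outcome_lookCur_aux l d y c x [] v

theorem outcome_lookVal (l d y c x : List (Letter F)) (u : Use F) (v : List F) :
    Outcome (.lookVal u) ⟨l, d, x, y, v.map .elem, [], c⟩ (look v l) (fun p => u.next p.1)
      (fun p t => ∃ d', t = ⟨p.2, d', x, y, v.map .elem, [], c⟩ ∧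
        d'.reverse ++ p.2 = d.reverse ++ l) :=
  outcome_lookVal_aux l d y c u v [] x

/-- The machine has no bound on the number of gates, whereas `evalGates` fails at bound `0`. The
hypothesis `hn` excludes that case: every gate consumes at least one letter. -/
theorem outcome_gates (x : List F) (y c : List (Letter F)) (n : ℕ) (l d : List (Letter F))
    (v : List F) (hn : l.length < n) :
    Outcome .gates ⟨l, d, x.map .elem, y, v.map .elem, [], c⟩ (evalGates x n v l) (fun _ => .outs)
      (fun p t => ∃ d', t = ⟨p.2, d', x.map .elem, y, p.1.map .elem, [], c⟩ ∧
        d'.reverse ++ p.2 = d.reverse ++ l) := by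
  induction n generalizing l d v with
  | zero => omega
  | succ n ih =>
    have key : ∀ (b : F) (l' d' : List (Letter F)), l'.length < n →
        d'.reverse ++ l' = d.reverse ++ l →
        Outcome (.append b) ⟨l', d', x.map .elem, y, v.map .elem, [], c⟩
          (evalGates x n (v ++ [b]) l') (fun _ => .outs)
          (fun p t => ∃ d', t = ⟨p.2, d', x.map .elem, y, p.1.map .elem, [], c⟩ ∧
            d'.reverse ++ p.2 = d.reverse ++ l) := by
      intro b l' d' hl' hd'
      have h := (leads_append l' d' (x.map .elem) y (v.map .elem) c b).outcome
        (by simpa using ih l' d' (v ++ [b]) hl')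
      rwa [hd'] at h
    -- Both operations share this run; the first operand is carried in the label `.snd m b`.
    have binary : ∀ (m : Bool) (l₁ d₁ : List (Letter F)), l₁.length < n →
        d₁.reverse ++ l₁ = d.reverse ++ l →
        Outcome (.lookVal (.fst m)) ⟨l₁, d₁, x.map .elem, y, v.map .elem, [], c⟩
          ((look v l₁).bind fun p => (look v p.2).bind fun q =>
            evalGates x n (v ++ [if m then p.1 * q.1 else p.1 + q.1]) q.2) (fun _ => .outs)
          (fun p t => ∃ d', t = ⟨p.2, d', x.map .elem, y, p.1.map .elem, [], c⟩ ∧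
            d'.reverse ++ p.2 = d.reverse ++ l) := by
      intro m l₁ d₁ hl₁ hd₁
      refine (outcome_lookVal l₁ d₁ y c _ _ v).bind ?_
      rintro ⟨b, l₂⟩ _ hb ⟨d₂, rfl, hd₂⟩
      refine (outcome_lookVal l₂ d₂ y c _ (.snd m b) v).bind ?_
      rintro ⟨b', l₃⟩ _ hb' ⟨d₃, rfl, hd₃⟩
      have h1 := length_lt_of_look_eq_some hb
      have h2 := length_lt_of_look_eq_some hb'
      exact key _ _ _ (by simp only at h1 h2 ⊢; omega) (hd₃.trans (hd₂.trans hd₁))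
    cases l with
    | nil => exact rejects_of_step ⟨[], .sep :: d, x.map .elem, y, v.map .elem, [], c⟩ fun s => by simp
    | cons b l =>
      have hl : l.length < n := by simpa using hn
      rcases b with b | _ | _ | _ | _ | _ | _
      case elem =>
        refine Leads.outcome (l' := .append b) (t' := ⟨l, .elem b :: d, x.map .elem, y, v.map .elem, [], c⟩)
          (.of_step fun s => by simp) ?_
        exact key _ _ _ hl (by simp)
      case input =>
        refine Leads.outcome (l' := .lookCur) (t' := ⟨l, .input :: d, x.map .elem, y, v.map .elem, [], c⟩)
          (.of_step fun s => by simp) ?_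
        refine (outcome_lookCur l _ y c _ x).bind ?_
        rintro ⟨b, l₂⟩ _ hb ⟨d₂, rfl, hd₂⟩
        have h1 := length_lt_of_look_eq_some hb
        exact key _ _ _ (by simp only at h1 ⊢; omega) (by simpa using hd₂)
      case add =>
        refine Leads.outcome (l' := .lookVal (.fst false))
          (t' := ⟨l, .add :: d, x.map .elem, y, v.map .elem, [], c⟩) (.of_step fun s => by simp) ?_
        exact binary false l _ hl (by simp)
      case mul =>
        refine Leads.outcome (l' := .lookVal (.fst true))
          (t' := ⟨l, .mul :: d, x.map .elem, y, v.map .elem, [], c⟩) (.of_step fun s => by simp) ?_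
        exact binary true l _ hl (by simp)
      case sep =>
        exact ⟨_, ⟨.sep :: d, rfl, by simp⟩, .of_step fun s => by simp⟩
      all_goals exact rejects_of_step ⟨l, _ :: d, x.map .elem, y, v.map .elem, [], c⟩ fun s => by simp; rfl

/-- Each output value removes one entry of the current tuple, so that this tuple counts the outputs
still to come. Its values are no longer needed for evaluating gates. -/
theorem outcome_outs (v x : List F) (l d y c : List (Letter F)) :
    Outcome .outs ⟨l, d, x.map .elem, y, v.map .elem, [], c⟩ (evalOuts v x l)
      (fun _ => .clearVals)
      (fun z t => ∃ d', t = ⟨[], d', [], (z.map .elem).reverse ++ y, v.map .elem, [], c⟩ ∧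
        d'.reverse = d.reverse ++ l) := by
  induction x generalizing l d y with
  | nil =>
    cases l with
    | nil =>
      exact ⟨_, ⟨d, rfl, by simp⟩, .trans (l' := .fin) (t' := ⟨[], d, [], y, v.map .elem, [], c⟩)
        (.of_step fun s => by simp) (.of_step fun s => by simp)⟩
    | cons b l =>
      refine Leads.rejects (l' := .lookVal .out) (t' := ⟨b :: l, d, [], y, v.map .elem, [], c⟩)
        (.of_step fun s => by simp) ?_
      -- There is one output too many. The machine still reads a number; even if that succeeds,
      -- `.emit` finds no entry left and rejects.
      have h := outcome_lookVal (b :: l) d y c [] .out v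
      generalize look v (b :: l) = o at h
      cases o with
      | none => exact h
      | some p =>
        obtain ⟨_, ⟨d', rfl, -⟩, h⟩ := h
        exact h.rejects (rejects_of_step ⟨p.2, d', [], y, v.map .elem, [], c⟩ fun s => by simp [Use.next])
  | cons a x ih =>
    cases l with
    | nil =>
      rw [evalOuts, show look v [] = none by cases v <;> rfl]
      exact Leads.rejects (l' := .fin) (t' := ⟨[], d, .elem a :: x.map .elem, y, v.map .elem, [], c⟩)
        (.of_step fun s => by simp) (rejects_of_step ⟨[], d, .elem a :: x.map .elem, y, v.map .elem, [], c⟩ fun s => by simp)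
    | cons b l =>
      refine Leads.outcome (l' := .lookVal .out)
        (t' := ⟨b :: l, d, .elem a :: x.map .elem, y, v.map .elem, [], c⟩) (.of_step fun s => by simp) ?_
      refine (outcome_lookVal (b :: l) d y c _ .out v).bind ?_
      rintro ⟨b', l₂⟩ _ - ⟨d₂, rfl, hd₂⟩
      refine Leads.outcome (l' := .outs) (t' := ⟨l₂, d₂, x.map .elem, .elem b' :: y, v.map .elem, [], c⟩)
        (.of_step fun s => by simp [Use.next]) ?_
      refine (ih l₂ d₂ (.elem b' :: y)).map ?_
      rintro z _ ⟨d', rfl, hd'⟩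
      exact ⟨.refl _ _, d', by simp, hd'.trans hd₂⟩

theorem outcome_check (g c : List (Letter F)) (x : List F) (hx : x.head? = some 0) :
    Outcome .check ⟨g, [], x.map .elem, [], [], [], c⟩ (evalCode g x) (fun _ => .inc)
      (fun z t => t = ⟨g, [], [], (z.map .elem).reverse, [], [], c⟩) := by
  obtain ⟨x, rfl⟩ : ∃ x', x = 0 :: x' := by
    cases x <;> simp_all
  refine Leads.outcome (l' := .gates) (t' := ⟨g, [], .elem 0 :: x.map .elem, [], [], [], c⟩)
    (.of_step fun s => by simp) ?_
  refine (outcome_gates (0 :: x) [] c (g.length + 1) g [] [] (by simp)).bind ?_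
  rintro ⟨v, l⟩ _ - ⟨d, rfl, hd⟩
  have h := outcome_outs v (0 :: x) l d [] c
  generalize evalOuts v (0 :: x) l = o at h
  cases o with
  | none => exact h
  | some z =>
    obtain ⟨_, ⟨d', rfl, hd'⟩, h⟩ := h
    refine ⟨_, rfl, h.trans ((leads_clearVals ..).trans ?_)⟩
    have h' := leads_rewind [] d' [] ((z.map Letter.elem).reverse ++ []) [] [] c
    simp only at hd
    -- The two conservation equations show that rewinding restores exactly `g`.
    rw [hd', hd] at h'
    simpa using h'

theorem rejects_check (g c : List (Letter F)) (x : List F) (hx : x.head? ≠ some 0) :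
    Rejects .check ⟨g, [], x.map .elem, [], [], [], c⟩ := by
  refine rejects_of_step ⟨g, [], x.map .elem, [], [], [], c⟩ fun s => ?_
  cases x <;> simp_all

/-! ### The counter -/

/-- The number with given digits, the least significant one first. -/
noncomputable def counterValue : List F → ℕ
  | [] => 0
  | a :: l => Finite.equivFin F a + Nat.card F * counterValue l

/-- The next value of the counter. -/
noncomputable def counterSucc : List F → Option (List F)
  | [] => none
  | a :: l => match digitSucc a with
    | some b => some (b :: l)
    | none => (counterSucc l).map (digitZero :: ·)

theorem counterSucc_eq_none {l : List F} (h : counterSucc l = none) :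
    counterValue l + 1 = Nat.card F ^ l.length := by
  induction l with
  | nil => rfl
  | cons a l ih =>
    have ha := (Finite.equivFin F a).is_lt
    unfold counterSucc digitSucc at h
    split_ifs at h with h1
    have := ih (by simpa using h)
    rw [counterValue, List.length_cons, pow_succ', ← this, mul_add]
    omega

theorem counterSucc_eq_some {l l' : List F} (h : counterSucc l = some l') :
    counterValue l' = counterValue l + 1 ∧ l'.length = l.length := by
  induction l generalizing l' with
  | nil => simp [counterSucc] at h
  | cons a l ih =>
    have ha := (Finite.equivFin F a).is_lt
    unfold counterSucc digitSucc at h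
    split_ifs at h with h1
    · obtain rfl : _ = l' := by simpa using h
      simp [counterValue]
      omega
    · obtain ⟨l'', h2, rfl⟩ : ∃ l'', counterSucc l = some l'' ∧ digitZero :: l'' = l' := by
        simpa using h
      obtain ⟨h3, h4⟩ := ih h2
      simp only [counterValue, h3, digitZero, Equiv.apply_symm_apply, List.length_cons, h4,
        mul_add, and_true]
      omega

theorem counterValue_lt {E : Type} [Finite E] (l : List E) :
    counterValue l < Nat.card E ^ l.length := by
  induction l with
  | nil => simp [counterValue]
  | cons a l ih =>
    have ha := (Finite.equivFin E a).is_lt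
    have := Nat.mul_le_mul_left (Nat.card E) (Nat.succ_le_of_lt ih)
    rw [counterValue, List.length_cons, pow_succ']
    rw [Nat.succ_eq_add_one, mul_add] at this
    omega

theorem counterValue_replicate (n : ℕ) :
    counterValue (List.replicate n (digitZero : F)) = 0 := by
  induction n with
  | zero => rfl
  | succ n ih =>
    rw [List.replicate_succ, counterValue, ih, digitZero, Equiv.apply_symm_apply, mul_zero,
      add_zero]

theorem leads_inc_of_none (i d x y v a : List (Letter F)) {c : List F}
    (h : counterSucc c = none) :
    ∃ t', Leads .inc ⟨i, d, x, y, v, a, c.map .elem⟩ (.clear true) t' := by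
  induction c generalizing a with
  | nil => exact ⟨⟨i, d, x, y, v, a, []⟩, .of_step fun s => by simp⟩
  | cons b c ih =>
    unfold counterSucc at h
    cases hb : digitSucc b with
    | some b' => simp [hb] at h
    | none =>
      obtain ⟨t', h⟩ := ih (.elem digitZero :: a) (by simpa [hb] using h)
      exact ⟨t', .trans (.of_step fun s => by simp [hb]) h⟩

/-- During the carry, `a` accumulates the digits that have wrapped around to zero. -/
theorem leads_inc_of_some (i d x y v a : List (Letter F)) {c c' : List F}
    (h : counterSucc c = some c') :
    Leads .inc ⟨i, d, x, y, v, a, c.map .elem⟩ .load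
      ⟨i, d, x, y, v, [], a.reverse ++ c'.map .elem⟩ := by
  induction c generalizing a c' with
  | nil => simp [counterSucc] at h
  | cons b c ih =>
    unfold counterSucc at h
    cases hb : digitSucc b with
    | some b' =>
      obtain rfl : _ = c' := by simpa [hb] using h
      exact .trans (l' := .restCnt) (t' := ⟨i, d, x, y, v, a, .elem b' :: c.map .elem⟩)
        (.of_step fun s => by simp [hb]) (leads_restCnt ..)
    | none =>
      obtain ⟨c'', h2, rfl⟩ : ∃ c'', counterSucc c = some c'' ∧ digitZero :: c'' = c' := by
        simpa [hb] using h
      refine .trans (l' := .inc) (t' := ⟨i, d, x, y, v, .elem digitZero :: a, c.map .elem⟩)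
        (.of_step fun s => by simp [hb]) ?_
      simpa using ih (.elem digitZero :: a) h2

/-! ### The decision -/

/-- The machine gets to the label for the answer `p`. -/
def Answers (l : Lbl F) (t : Mem F) (p : Prop) : Prop :=
  (p → ∃ t', Leads l t (.clear true) t') ∧ (¬ p → Rejects l t)

theorem Leads.answers {l l' : Lbl F} {t t' : Mem F} (h : Leads l t l' t') {p : Prop}
    (h' : Answers l' t' p) : Answers l t p := by
  refine ⟨fun hp => ?_, fun hp => h.rejects (h'.2 hp)⟩
  obtain ⟨t'', h1⟩ := h'.1 hp
  exact ⟨t'', h.trans h1⟩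

/-- The hypothesis `hc` says that the counter overflows after exactly `n + 1` increments. Each round
checks and evaluates before it increments, so these are the rounds demanded by `ZeroUpTo g (n + 1)`.
-/
theorem answers_check (g : List (Letter F)) (n : ℕ) (x c : List F)
    (hc : counterValue c + (n + 1) = Nat.card F ^ c.length) :
    Answers .check ⟨g, [], x.map .elem, [], [], [], c.map .elem⟩ (ZeroUpTo g (n + 1) x) := by
  induction n generalizing x c with
  | zero =>
    refine ⟨fun ⟨hx, x', hx', _⟩ => ?_, fun h => ?_⟩
    · have h := outcome_check g (c.map .elem) x hx
      rw [hx'] at h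
      obtain ⟨_, rfl, h⟩ := h
      -- The counter stands at its maximum `q ^ c.length - 1`, and a successor would exceed the
      -- range.
      have hnone : counterSucc c = none := by
        rw [Option.eq_none_iff_forall_ne_some]
        intro c' hc'
        have h1 := counterSucc_eq_some hc'
        have h2 : counterValue c' < Nat.card F ^ c'.length := counterValue_lt c'
        rw [h1.2] at h2
        omega
      obtain ⟨t', h'⟩ := leads_inc_of_none g [] [] (x'.map .elem).reverse [] [] hnone
      exact ⟨t', h.trans h'⟩
    · by_cases hx : x.head? = some 0
      · have h1 := outcome_check g (c.map .elem) x hx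
        cases hx' : evalCode g x with
        | none => rwa [hx'] at h1
        | some x' => exact absurd ⟨hx, x', hx', trivial⟩ h
      · exact rejects_check _ _ _ hx
  | succ n ih =>
    by_cases hx : x.head? = some 0
    · have h1 := outcome_check g (c.map .elem) x hx
      cases hx' : evalCode g x with
      | none =>
        rw [hx'] at h1
        refine ⟨fun ⟨_, x', h2, _⟩ => ?_, fun _ => h1⟩
        rw [hx'] at h2
        cases h2
      | some x' =>
        rw [hx'] at h1
        obtain ⟨_, rfl, h1⟩ := h1
        obtain ⟨c', hc'⟩ : ∃ c', counterSucc c = some c' := by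
          rw [← Option.ne_none_iff_exists']
          intro h
          have := counterSucc_eq_none h
          omega
        obtain ⟨h3, h4⟩ := counterSucc_eq_some hc'
        have h5 : ZeroUpTo g (n + 1 + 1) x ↔ ZeroUpTo g (n + 1) x' := by
          rw [ZeroUpTo]
          simp [hx, hx']
        rw [h5]
        refine Leads.answers (h1.trans ((leads_inc_of_some g [] [] _ [] [] hc').trans
          (leads_load ..))) ?_
        have := ih x' c' (by rw [h4, h3]; omega)
        simpa using this
    · exact ⟨fun h => absurd h.1 hx, fun _ => rejects_check _ _ _ hx⟩

/-- Each initial value contributes one zero digit, which sizes the counter for `q ^ k` rounds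
without any arithmetic. -/
theorem outcome_init (w y c : List (Letter F)) :
    Outcome .init ⟨w, [], [], y, [], [], c⟩ (splitInitial w) (fun _ => .load)
      (fun p t => t = ⟨p.2, [], [], (p.1.map .elem).reverse ++ y, [], [],
        List.replicate p.1.length (.elem digitZero) ++ c⟩) := by
  induction w generalizing y c with
  | nil => exact rejects_of_step ⟨[], [], [], y, [], [], c⟩ fun s => by simp
  | cons b w ih =>
    rcases b with b | _ | _ | _ | _ | _ | _
    case elem =>
      refine Leads.outcome (l' := .init)
        (t' := ⟨w, [], [], .elem b :: y, [], [], .elem digitZero :: c⟩)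
        (.of_step fun s => by simp) ?_
      refine (ih (.elem b :: y) (.elem digitZero :: c)).map ?_
      rintro ⟨x, g⟩ _ rfl
      refine ⟨.refl _ _, ?_⟩
      simp [List.replicate_succ', List.append_assoc]
    case sep => exact ⟨_, rfl, .of_step fun s => by simp⟩
    all_goals exact rejects_of_step ⟨w, [], [], y, [], [], c⟩ fun s => by simp

theorem answers_init (w : List (Letter F)) :
    Answers .init ⟨w, [], [], [], [], [], []⟩ (w ∈ zeronessProblem F) := by
  rw [mem_zeronessProblem_iff]
  have h := outcome_init w [] []
  cases hw : splitInitial w with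
  | none => exact ⟨fun ⟨x, g, h', _⟩ => by simp at h', fun _ => by rwa [hw] at h⟩
  | some p =>
    obtain ⟨x, g⟩ := p
    rw [hw] at h
    obtain ⟨_, rfl, h⟩ := h
    simp only [Option.some.injEq, Prod.mk.injEq, ↓existsAndEq, true_and]
    have hpos : 0 < Nat.card F ^ x.length := pow_pos Nat.card_pos _
    obtain ⟨N, hN⟩ : ∃ N, Nat.card F ^ x.length = N + 1 := ⟨_, (Nat.succ_pred hpos.ne').symm⟩
    rw [hN]
    refine (h.trans (leads_load ..)).answers ?_
    have := answers_check g N x (List.replicate x.length digitZero)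
      (by rw [counterValue_replicate, List.length_replicate, hN, zero_add])
    simpa using this

/-! ### Halting -/

/-- The output convention requires every other stack to be empty and the register to be back at
`none`. Each pass pops every stack once, and the register keeps the first letter found; it is `none`
only when all stacks were empty. -/
theorem reaches_halt (b : Bool) (s : Reg F) (t : Mem F) :
    Reaches (TM2.step prog) ⟨some (.clear b), s, t.stk⟩
      ⟨none, none, Function.update (Mem.stk ⟨[], [], [], [], [], [], []⟩) .out [b]⟩ := by
  obtain ⟨i, d, x, y, v, a, c⟩ := t
  induction hn : i.length + d.length + x.length + y.length + v.length + a.length + c.length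
    using Nat.strong_induction_on generalizing i d x y v a c s with
  | _ n ih =>
    subst hn
    by_cases h0 : i.length + d.length + x.length + y.length + v.length + a.length + c.length = 0
    · simp only [Nat.add_eq_zero_iff, List.length_eq_zero_iff] at h0
      obtain ⟨⟨⟨⟨⟨⟨rfl, rfl⟩, rfl⟩, rfl⟩, rfl⟩, rfl⟩, rfl⟩ := h0
      exact Relation.ReflTransGen.single (by simp [TM2.step])
    · have hs : ((((((i.head?).or d.head?).or x.head?).or y.head?).or v.head?).or
          a.head?).or c.head? ≠ none := by
        intro h
        simp only [Option.or_eq_none_iff, List.head?_eq_none_iff] at h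
        simp [h] at h0
      refine Relation.ReflTransGen.head ?_ (ih _ ?_ (((((((i.head?).or d.head?).or
        x.head?).or y.head?).or v.head?).or a.head?).or c.head?) i.tail d.tail x.tail y.tail
        v.tail a.tail c.tail rfl)
      · simp [TM2.step, Option.isSome_iff_ne_none.2 hs]
      · simp only [List.length_tail]
        omega

/-! ### The space bound -/

/-- Bounds on the lengths of the stacks that hold whenever the machine is at a label, for an input
of length `n`. -/
def SpaceInv {F : Type} (n : ℕ) : Lbl F → Mem F → Prop
  | .init, ⟨i, d, x, y, v, a, c⟩ => i.length + y.length ≤ n ∧ c.length ≤ y.length ∧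
      d.length + x.length + v.length + a.length = 0
  | .lookCur, ⟨i, d, x, y, v, a, c⟩ | .restCur _, ⟨i, d, x, y, v, a, c⟩ =>
      i.length + d.length ≤ n ∧ x.length + y.length + a.length ≤ n ∧
      v.length + 1 ≤ d.length ∧ c.length ≤ n
  | .append _, ⟨i, d, x, y, v, a, c⟩
  | .lookVal (.fst _), ⟨i, d, x, y, v, a, c⟩ | .restVal (.fst _) _, ⟨i, d, x, y, v, a, c⟩
  | .lookVal (.snd _ _), ⟨i, d, x, y, v, a, c⟩ | .restVal (.snd _ _) _, ⟨i, d, x, y, v, a, c⟩ =>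
      i.length + d.length ≤ n ∧ x.length + y.length ≤ n ∧
      v.length + a.length + 1 ≤ d.length ∧ c.length ≤ n
  | .restGates, ⟨i, d, x, y, v, a, c⟩ | .lookVal .out, ⟨i, d, x, y, v, a, c⟩
  | .restVal .out _, ⟨i, d, x, y, v, a, c⟩ =>
      i.length + d.length ≤ n ∧ x.length + y.length ≤ n ∧
      v.length + a.length ≤ d.length ∧ c.length ≤ n
  | .rewind, ⟨i, d, x, y, v, a, c⟩ | .inc, ⟨i, d, x, y, v, a, c⟩
  | .restCnt, ⟨i, d, x, y, v, a, c⟩ =>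
      i.length + d.length ≤ n ∧ x.length + y.length ≤ n ∧ v.length = 0 ∧
      c.length + a.length ≤ n
  | .clear _, ⟨i, d, x, y, v, a, c⟩ =>
      i.length + d.length + x.length + y.length + v.length + a.length + c.length ≤ 4 * n + 3
  | _, ⟨i, d, x, y, v, a, c⟩ =>
      i.length + d.length ≤ n ∧ x.length + y.length ≤ n ∧ v.length ≤ d.length ∧ a.length = 0 ∧
      c.length ≤ n

/-- The invariant of configurations. -/
inductive CfgInv {F : Type} (n : ℕ) : TM2.Cfg (Sym F) (Lbl F) (Reg F) → Prop
  | halt (b : Bool) (s : Reg F) :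
      CfgInv n ⟨none, s, Function.update (Mem.stk ⟨[], [], [], [], [], [], []⟩) .out [b]⟩
  | run {l : Lbl F} {s : Reg F} {t : Mem F} (h : SpaceInv n l t) : CfgInv n ⟨some l, s, t.stk⟩

-- Input letters only move between `inp` and `done`, and tuple entries only between `cur`, `nxt` and
-- `aux`. Every gate value is paid for by a letter in `done`; the `+ 1` in `SpaceInv` is the letter
-- of the gate whose value is still to be appended. The values are cleared before rewinding shrinks
-- `done`. The additive constant at `.clear` absorbs the default letter pushed when the input is
-- exhausted.
set_option linter.unusedSimpArgs false in
theorem cfgInv_stepAux {n : ℕ} {l : Lbl F} {t : Mem F} (h : SpaceInv n l t) (s : Reg F) :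
    CfgInv n (TM2.stepAux (prog l) s t.stk) := by
  obtain ⟨i, d, x, y, v, a, c⟩ := t
  cases l with
  | init =>
    rcases i with _ | ⟨(_ | _ | _ | _ | _ | _ | _), i⟩ <;> simp <;> refine .run ?_ <;>
      simp only [SpaceInv, List.length_cons, List.length_nil, true_and] at h ⊢ <;> omega
  | load =>
    cases y <;> simp <;> refine .run ?_ <;>
      simp only [SpaceInv, List.length_cons, List.length_nil, true_and] at h ⊢ <;> omega
  | check =>
    rcases x with _ | ⟨(b | _ | _ | _ | _ | _ | _), x⟩
    case cons.elem =>
      by_cases hb : b = 0 <;> simp [hb] <;> refine .run ?_ <;>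
      simp only [SpaceInv, List.length_cons, List.length_nil, true_and] at h ⊢ <;> omega
    all_goals
      simp
      refine .run ?_
      simp only [SpaceInv, List.length_cons, List.length_nil, true_and] at h ⊢
      omega
  | gates =>
    rcases i with _ | ⟨(_ | _ | _ | _ | _ | _ | _), i⟩ <;> simp <;> refine .run ?_ <;>
      simp only [SpaceInv, List.length_cons, List.length_nil, true_and] at h ⊢ <;> omega
  | lookCur =>
    rcases i with _ | ⟨(_ | _ | _ | _ | _ | _ | _), i⟩ <;>
      rcases x with _ | ⟨(_ | _ | _ | _ | _ | _ | _), x⟩ <;> simp <;> refine .run ?_ <;>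
      simp only [SpaceInv, List.length_cons, List.length_nil, true_and] at h ⊢ <;> omega
  | restCur b =>
    cases a <;> simp <;> refine .run ?_ <;>
      simp only [SpaceInv, List.length_cons, List.length_nil, true_and] at h ⊢ <;> omega
  | append b =>
    cases v <;> simp <;> refine .run ?_ <;>
      simp only [SpaceInv, List.length_cons, List.length_nil, true_and] at h ⊢ <;> omega
  | restGates =>
    cases a <;> simp <;> refine .run ?_ <;>
      simp only [SpaceInv, List.length_cons, List.length_nil, true_and] at h ⊢ <;> omega
  | lookVal u =>
    rcases i with _ | ⟨(_ | _ | _ | _ | _ | _ | _), i⟩ <;>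
      rcases v with _ | ⟨(_ | _ | _ | _ | _ | _ | _), v⟩ <;> simp <;> refine .run ?_ <;>
      cases u <;>
      simp only [SpaceInv, List.length_cons, List.length_nil, true_and] at h ⊢ <;> omega
  | restVal u b =>
    cases a <;> cases u <;> simp [Use.next] <;> refine .run ?_ <;>
      simp only [SpaceInv, List.length_cons, List.length_nil, true_and] at h ⊢ <;>
      omega
  | outs =>
    cases i <;> simp <;> refine .run ?_ <;>
      simp only [SpaceInv, List.length_cons, List.length_nil, true_and] at h ⊢ <;> omega
  | emit b =>
    cases x <;> simp <;> refine .run ?_ <;>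
      simp only [SpaceInv, List.length_cons, List.length_nil, true_and] at h ⊢ <;> omega
  | fin =>
    cases x <;> simp <;> refine .run ?_ <;>
      simp only [SpaceInv, List.length_cons, List.length_nil, true_and] at h ⊢ <;> omega
  | clearVals =>
    cases v <;> simp <;> refine .run ?_ <;>
      simp only [SpaceInv, List.length_cons, List.length_nil, true_and] at h ⊢ <;> omega
  | rewind =>
    cases d <;> simp <;> refine .run ?_ <;>
      simp only [SpaceInv, List.length_cons, List.length_nil, true_and] at h ⊢ <;> omega
  | inc =>
    rcases c with _ | ⟨(b | _ | _ | _ | _ | _ | _), c⟩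
    case cons.elem =>
      cases hb : digitSucc b <;> simp [hb] <;> refine .run ?_ <;>
      simp only [SpaceInv, List.length_cons, List.length_nil, true_and] at h ⊢ <;>
        omega
    all_goals
      simp
      refine .run ?_
      simp only [SpaceInv, List.length_cons, List.length_nil, true_and] at h ⊢
      omega
  | restCnt =>
    cases a <;> simp <;> refine .run ?_ <;>
      simp only [SpaceInv, List.length_cons, List.length_nil, true_and] at h ⊢ <;> omega
  | clear b =>
    by_cases h0 : (((((((i.head?).or d.head?)).or x.head?).or y.head?).or v.head?).or
        a.head?).or c.head? = none
    · have h1 := h0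
      simp only [Option.or_eq_none_iff, List.head?_eq_none_iff] at h1
      obtain ⟨⟨⟨⟨⟨⟨rfl, rfl⟩, rfl⟩, rfl⟩, rfl⟩, rfl⟩, rfl⟩ := h1
      simpa using CfgInv.halt b none
    · simp [Option.isSome_iff_ne_none.2 h0]
      refine .run ?_
      simp only [SpaceInv, List.length_tail] at h ⊢
      omega

theorem CfgInv.of_reaches {n : ℕ} {c c' : TM2.Cfg (Sym F) (Lbl F) (Reg F)} (h : CfgInv n c)
    (hc : Reaches (TM2.step prog) c c') : CfgInv n c' := by
  induction hc with
  | refl => exact h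
  | tail _ hstep ih =>
    cases ih with
    | halt b s => simp [TM2.step] at hstep
    | run h =>
      obtain rfl := Option.some.inj hstep
      exact cfgInv_stepAux h _

theorem CfgInv.sum_length_le {F : Type} {n : ℕ} {c : TM2.Cfg (Sym F) (Lbl F) (Reg F)}
    (h : CfgInv n c) : ∑ k, (c.stk k).length ≤ 4 * n + 3 := by
  have hsum : ∀ f : Stack → ℕ, ∑ k, f k = f (.work .inp) + (f (.work .done) + (f (.work .cur) +
      (f (.work .nxt) + (f (.work .vals) + (f (.work .aux) + (f (.work .cnt) + f .out)))))) := by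
    intro f
    change ∑ k ∈ ({.work .inp, .work .done, .work .cur, .work .nxt, .work .vals, .work .aux,
      .work .cnt, .out} : Finset Stack), f k = _
    simp
  rw [hsum]
  cases h with
  | halt b s => simp [Function.update]
  | @run l s t h =>
    obtain ⟨i, d, x, y, v, a, c⟩ := t
    rcases l with _ | _ | _ | _ | _ | _ | _ | _ | (_ | _ | _) | ⟨_ | _ | _, _⟩ | _ | _ | _ | _ |
      _ | _ | _ | _ <;> simp only [stk_inp, stk_done, stk_cur, stk_nxt, stk_vals, stk_aux,
        stk_cnt, stk_out, List.length_nil, SpaceInv] at h ⊢ <;> omega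

/-! ### The zeroness problem is in `PSPACE` -/

instance {F : Type} [Finite F] : Finite (Letter F) := by
  let f : Letter F → F ⊕ Fin 6
    | .elem a => .inl a
    | .input => .inr 0
    | .add => .inr 1
    | .mul => .inr 2
    | .tick => .inr 3
    | .endMark => .inr 4
    | .sep => .inr 5
  refine Finite.of_injective f fun a b h => ?_
  cases a <;> cases b <;> simp_all [f]

instance {F : Type} [Finite F] : Finite (Lbl F) := by
  have := Fintype.ofFinite F
  infer_instance

variable (F) in
/-- The machine that decides the zeroness problem. -/
noncomputable def machine : FinTM2 where
  K := Stack
  k₀ := .work .inp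
  k₁ := .out
  Γ := Sym F
  Λ := Lbl F
  main := .init
  ΛFin := Fintype.ofFinite _
  σ := Reg F
  initialState := none
  σFin := Fintype.ofFinite _
  Γk₀Fin := Fintype.ofFinite (Letter F)
  m := prog

theorem initList_machine (w : List (Letter F)) :
    initList (machine F) w = ⟨some .init, none, Mem.stk ⟨w, [], [], [], [], [], []⟩⟩ := by
  unfold initList
  congr 1
  funext k
  rcases k with (_ | _) | _ <;> rfl

theorem haltList_machine (b : Bool) : haltList (machine F) [b] =
    ⟨none, none, Function.update (Mem.stk ⟨[], [], [], [], [], [], []⟩) .out [b]⟩ := by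
  unfold haltList
  congr 1
  funext k
  rcases k with (_ | _) | _ <;> rfl

/-- `EvalsTo` carries a step count as data, so a mere proposition yields only nonemptiness. -/
theorem nonempty_evalsTo_of_reaches {α : Type*} {f : α → Option α} {a b : α}
    (h : Reaches f a b) : Nonempty (EvalsTo f a (some b)) := by
  induction h with
  | refl => exact ⟨.refl f a⟩
  | tail _ h ih =>
    obtain ⟨e⟩ := ih
    exact ⟨e.trans _ _ _ _ ⟨1, h⟩⟩

open Classical in
theorem reaches_output (w : List (Letter F)) :
    Reaches (machine F).step (initList (machine F) w)
      (haltList (machine F) [decide (w ∈ zeronessProblem F)]) := by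
  rw [initList_machine, haltList_machine]
  obtain ⟨h1, h2⟩ := answers_init w
  by_cases hw : w ∈ zeronessProblem F
  · obtain ⟨t, ⟨h⟩⟩ := h1 hw
    obtain ⟨s, h⟩ := h none
    rw [decide_eq_true hw]
    exact h.trans (reaches_halt true s t)
  · obtain ⟨t, ⟨h⟩⟩ := h2 hw
    obtain ⟨s, h⟩ := h none
    rw [decide_eq_false hw]
    exact h.trans (reaches_halt false s t)

variable (F) in
theorem zeronessProblem_mem_PSPACE : zeronessProblem F ∈ PSPACE (Letter F) := by
  classical
  have hinput : ∀ w : List (Letter F),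
      initList (machine F) (w.map (Equiv.refl (Letter F)).invFun) = initList (machine F) w :=
    fun w => congrArg (initList (machine F)) (List.map_id w)
  refine ⟨⟨⟨machine F, Equiv.refl _, Equiv.refl _⟩, fun w => ?_⟩, fun k => ?_, ?_⟩
  · have h := Classical.choice (nonempty_evalsTo_of_reaches (reaches_output w))
    rw [← hinput] at h
    exact h
  · change Finite (Sym F k)
    cases k <;> infer_instance
  -- Four groups of stacks hold at most `n` symbols each: input, tuples, gate values and counter.
  · refine ⟨4 * Polynomial.X + 3, fun w c hc => ?_⟩
    have hinit : CfgInv w.length (initList (machine F) w) := by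
      rw [initList_machine]
      exact .run (by simp [SpaceInv])
    have hc' : Reaches (machine F).step (initList (machine F) w) c := by
      rw [← hinput]
      exact hc
    have heval : (4 * Polynomial.X + 3 : Polynomial ℕ).eval w.length = 4 * w.length + 3 := by
      simp
    rw [heval]
    exact (hinit.of_reaches hc').sum_length_le

end ZeronessMachine

theorem theoremA3 (F : Type) [Field F] [Finite F] :
    zeronessProblem F ∈ PSPACE (Letter F) ∧
    ∀ (k : ℕ) (u : ℕ → F), IsPolyrec k u →
      ((∀ n, u n = 0) ↔ ∀ n < Nat.card F ^ k, u n = 0) :=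
  ⟨ZeronessMachine.zeronessProblem_mem_PSPACE F, fun _ _ hu => hu.eq_zero_iff⟩
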